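/- Let $m\ge 1$ be an integer, let $\boldsymbol\sigma=(\sigma_1,\dots,\sigma_m)\in\{0,1\}^m$, and put $$\mathcal H_m(\boldsymbol\sigma)=\left\{\left(\frac{t_m}{2}+\frac{t_{m-1}}{2^2}+\dots+\frac{t_1}{2^m},\ \frac{s_1}{2}+\frac{s_2}{2^2}+\dots+\frac{s_m}{2^m}\right): t_1,\dots,t_m\in\{0,1\}\right\},$$ where $s_j=t_j\oplus\sigma_j$ and $\oplus$ is addition modulo $2$. Let $$\widetilde{\mathcal H}_m^{\rm sym}(\boldsymbol\sigma)=\mathcal H_m(\boldsymbol\sigma)\cup\{(x,1-y):(x,y)\in\mathcal H_m(\boldsymbol\sigma)\},$$ where the union is taken with multiplicity, so that this point set has $N=2^{m+1}$ elements, some of which may coincide. For a finite point set $\mathcal P$ with $N$ elements (counted with multiplicity) let $$L_2(\mathcal P)=\frac1N\left(\int_0^1\!\int_0^1\bigl|A([0,\alpha)\times[0,\beta),\mathcal P)-N\alpha\beta\bigr|^2\,\mathrm d\alpha\,\mathrm d\beta\right)^{1/2},$$ where $A([0,\alpha)\times[0,\beta),\mathcal P)$ is the number of elements of $\mathcal P$,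 counted with multiplicity, that lie in $[0,\alpha)\times[0,\beta)$. Then, with $N=2^{m+1}$, $$L_2\bigl(\widetilde{\mathcal H}_m^{\rm sym}(\boldsymbol\sigma)\bigr)=\frac1N\sqrt{\frac{\log N}{24\log 2}}+\mathcal O\!\left(\frac1N\right),$$ where the implied constant is absolute: it depends neither on $m$ nor on $\boldsymbol\sigma$. -/

import Mathlib

noncomputable section

/-- `A([0,α) × [0,β), P)`: the number of points of `P`, counted with multiplicity, in
`[0,α) × [0,β)`. Finite point sets are multisets, since points may coincide. -/
def countInBox (P : Multiset (ℝ × ℝ)) (α β : ℝ) : ℕ :=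
  open Classical in P.countP (fun z => z ∈ Set.Ico 0 α ×ˢ Set.Ico 0 β)

/-- The local discrepancy `Δ(α,β,P) = A([0,α) × [0,β), P) - N α β`, with `N` the number of
points of `P`, counted with multiplicity. -/
def localDiscrepancy (P : Multiset (ℝ × ℝ)) (α β : ℝ) : ℝ :=
  (countInBox P α β : ℝ) - (Multiset.card P : ℝ) * α * β

/-- The `L_p` discrepancy
`L_p(P) = (1/N) (∫₀¹ ∫₀¹ |Δ(α,β,P)|^p dα dβ)^(1/p)`, for `1 ≤ p < ∞`. -/
def lpDiscrepancy (p : ℝ) (P : Multiset (ℝ × ℝ)) : ℝ :=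
  1 / (Multiset.card P : ℝ) *
    (∫ β in (0 : ℝ)..1, ∫ α in (0 : ℝ)..1, |localDiscrepancy P α β| ^ p) ^ (1 / p)

/-- The point of the shifted Hammersley point set with digits `t`. The indices run from `0`:
`t i` is `t_{i+1}` and `σ i` is `σ_{i+1}`. The first coordinate is
`t_m / 2 + t_{m-1} / 2^2 + ⋯ + t_1 / 2^m`, the second one is
`s_1 / 2 + s_2 / 2^2 + ⋯ + s_m / 2^m`, where `s_j = t_j + σ_j` modulo 2
(addition in `Fin 2` is modulo 2). -/
def hammersleyPoint (m : ℕ) (σ t : Fin m → Fin 2) : ℝ × ℝ :=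
  (∑ i : Fin m, ((t i : ℕ) : ℝ) / 2 ^ (m - (i : ℕ)),
   ∑ i : Fin m, (((t i + σ i : Fin 2) : ℕ) : ℝ) / 2 ^ ((i : ℕ) + 1))

/-- The digit shifted Hammersley point set `H_m(σ)`. -/
def hammersley (m : ℕ) (σ : Fin m → Fin 2) : Multiset (ℝ × ℝ) :=
  (Finset.univ : Finset (Fin m → Fin 2)).val.map (hammersleyPoint m σ)

/-- The symmetrization `H_m(σ) ∪ {(x, 1 - y) : (x, y) ∈ H_m(σ)}`, as a union with multiplicity:
it has `2^(m+1)` elements, some of which may coincide. -/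
def altSymHammersley (m : ℕ) (σ : Fin m → Fin 2) : Multiset (ℝ × ℝ) :=
  hammersley m σ + (hammersley m σ).map (fun z => (z.1, 1 - z.2))

end

/-! Up to an error of at most 3, the local discrepancy at `(α, β)` is `gridDiscrepancy` at the grid
cell of `(α, β)`, so in the `L_2` norm it is enough to compute one finite quadratic sum exactly. The
lowest binary digit of a column, shifted by `σ 0`, is the top digit of the height of its point.
Removing both digits gives a self-similarity: with `D` the grid discrepancy of level `m`, and `L`,
`U` the terms of the next column's point and of its mirror image, the four cells of level `m + 1`
over one cell carry `D`, `D`, `D + L`, `D + U`. The shift only permutes them, so the sums do not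
depend on `σ`. Hence the sum of squares `S` satisfies `S' = 4 S + 2 ∑ D (L + U) + ∑ (L² + U²)`, and
the cross sum `E = ∑ D (L + U)` satisfies `E' = 2 E + 2 ∑ L U`. Symmetrization makes `L + U` sum to
zero over each row, and no mean term growing with `m` survives. The sums of `L² + U²` and `L U` come
from counting; solving both recursions (`gridSum_mul_columnTerm`, `gridSum_gridDiscrepancy_sq`)
gives mean square `m / 24 + O(1)`. -/

noncomputable section

open MeasureTheory

/-! ### Points listed by column -/

/-- The numerator of the second coordinate of the point of the shifted Hammersley point set
whose first coordinate is `k / 2 ^ m`. -/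
def shiftedReversal : (m : ℕ) → (Fin m → Fin 2) → ℕ → ℕ
  | 0, _, _ => 0
  | m + 1, σ, k => (k + (σ 0 : ℕ)) % 2 * 2 ^ m + shiftedReversal m (fun i => σ i.succ) (k / 2)

theorem shiftedReversal_lt (m : ℕ) (σ : Fin m → Fin 2) (k : ℕ) :
    shiftedReversal m σ k < 2 ^ m := by
  induction m generalizing k with
  | zero => simp [shiftedReversal]
  | succ m ih =>
    have h := ih (fun i => σ i.succ) (k / 2)
    have h2 : (k + (σ 0 : ℕ)) % 2 * 2 ^ m ≤ 1 * 2 ^ m :=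
      Nat.mul_le_mul_right _ (by omega)
    rw [shiftedReversal, pow_succ]
    omega

theorem sum_range_two_mul_pairs {M : Type*} [AddCommMonoid M] (g : ℕ → M) (n : ℕ) :
    ∑ k ∈ Finset.range (2 * n), g k = ∑ k ∈ Finset.range n, (g (2 * k) + g (2 * k + 1)) := by
  induction n with
  | zero => simp
  | succ n ih =>
    rw [show 2 * (n + 1) = 2 * n + 1 + 1 by ring, Finset.sum_range_succ, Finset.sum_range_succ,
      ih, Finset.sum_range_succ, add_assoc]

theorem sum_range_two_pow_succ_low {M : Type*} [AddCommMonoid M] (g : ℕ → M) (m : ℕ) :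
    ∑ k ∈ Finset.range (2 ^ (m + 1)), g k
      = ∑ k ∈ Finset.range (2 ^ m), (g (2 * k) + g (2 * k + 1)) := by
  rw [pow_succ, mul_comm, sum_range_two_mul_pairs]

theorem sum_range_two_pow_succ_high {M : Type*} [AddCommMonoid M] (g : ℕ → M) (m : ℕ) :
    ∑ k ∈ Finset.range (2 ^ (m + 1)), g k
      = ∑ k ∈ Finset.range (2 ^ m), (g k + g (2 ^ m + k)) := by
  rw [pow_succ, mul_two, Finset.sum_range_add, Finset.sum_add_distrib]

/-- Induction peels off the first digit `t 0`: it is the lowest digit of the column index and, after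
the shift, the highest digit of the height. -/
theorem sum_hammersleyPoint (m : ℕ) (σ : Fin m → Fin 2) (g : ℝ × ℝ → ℝ) :
    ∑ t : Fin m → Fin 2, g (hammersleyPoint m σ t)
      = ∑ k ∈ Finset.range (2 ^ m), g ((k : ℝ) / 2 ^ m, (shiftedReversal m σ k : ℝ) / 2 ^ m) := by
  induction m generalizing g with
  | zero => simp [hammersleyPoint, shiftedReversal]
  | succ m ih =>
    have key : ∀ (t₀ : Fin 2) (t : Fin m → Fin 2),
        hammersleyPoint (m + 1) σ (Fin.cons t₀ t) =
          ((t₀ : ℕ) / 2 ^ (m + 1) + (hammersleyPoint m (fun i => σ i.succ) t).1,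
            (((t₀ + σ 0 : Fin 2) : ℕ) + (hammersleyPoint m (fun i => σ i.succ) t).2) / 2) := by
      intro t₀ t
      simp only [hammersleyPoint, Fin.sum_univ_succ, Fin.cons_zero, Fin.cons_succ, Fin.val_zero,
        Fin.val_succ, add_div, Finset.sum_div]
      refine Prod.ext ?_ ?_
      · simp
      · simp [pow_succ, div_div]
    rw [← (Fin.consEquiv (fun _ : Fin (m + 1) => Fin 2)).sum_comp, Fintype.sum_prod_type]
    simp only [Fin.consEquiv, Equiv.coe_fn_mk, key]
    have h1 : ∀ t₀ : Fin 2, ∑ t : Fin m → Fin 2,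
        g ((t₀ : ℕ) / 2 ^ (m + 1) + (hammersleyPoint m (fun i => σ i.succ) t).1,
            (((t₀ + σ 0 : Fin 2) : ℕ) + (hammersleyPoint m (fun i => σ i.succ) t).2) / 2)
        = ∑ k ∈ Finset.range (2 ^ m), g (((2 * k + (t₀ : ℕ) : ℕ) : ℝ) / 2 ^ (m + 1),
            (shiftedReversal (m + 1) σ (2 * k + (t₀ : ℕ)) : ℝ) / 2 ^ (m + 1)) := by
      intro t₀
      rw [ih (fun i => σ i.succ)
        (fun z => g ((t₀ : ℕ) / 2 ^ (m + 1) + z.1, (((t₀ + σ 0 : Fin 2) : ℕ) + z.2) / 2))]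
      refine Finset.sum_congr rfl fun k _ => ?_
      congr 1
      have e1 : (2 * k + (t₀ : ℕ)) / 2 = k := by omega
      have e2 : (2 * k + (t₀ : ℕ) + (σ 0 : ℕ)) % 2 = ((t₀ + σ 0 : Fin 2) : ℕ) := by
        rw [Fin.val_add]; omega
      have hm : (2 : ℝ) ^ m ≠ 0 := by positivity
      rw [shiftedReversal, e1, e2]
      refine Prod.ext ?_ ?_
      · push_cast; field_simp; ring
      · push_cast; field_simp; ring
    simp only [h1, Fin.sum_univ_two, ← Finset.sum_add_distrib]
    rw [sum_range_two_pow_succ_low]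
    simp

/-! ### Self-similarity of the grid discrepancy -/

/-- The indicator that the point of `hammersley m σ` in column `k` lies below the height
`(2 b + 1) / 2 ^ (m + 1)`, minus that height. -/
def lowerTerm (m : ℕ) (σ : Fin m → Fin 2) (k b : ℕ) : ℝ :=
  (if shiftedReversal m σ k ≤ b then 1 else 0) - (2 * b + 1) / 2 ^ (m + 1)

/-- The counterpart of `lowerTerm` for the point reflected at the height `1 / 2`. -/
def upperTerm (m : ℕ) (σ : Fin m → Fin 2) (k b : ℕ) : ℝ :=
  (if 2 ^ m ≤ shiftedReversal m σ k + b then 1 else 0) - (2 * b + 1) / 2 ^ (m + 1)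

/-- The contribution of the column `k` to the discrete local discrepancy. -/
def columnTerm (m : ℕ) (σ : Fin m → Fin 2) (k b : ℕ) : ℝ :=
  lowerTerm m σ k b + upperTerm m σ k b

/-- The local discrepancy of the symmetrized point set on the grid. -/
def gridDiscrepancy (m : ℕ) (σ : Fin m → Fin 2) (a b : ℕ) : ℝ :=
  ∑ k ∈ Finset.range a, columnTerm m σ k b

/-- The shifted digit decides which half contains the point. In a row of the lower half, only the
point or only its reflection can be counted; the other lies too high. -/
theorem columnTerm_succ_low (m : ℕ) (σ : Fin (m + 1) → Fin 2) (k a₀ b : ℕ) (ha : a₀ < 2)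
    (hb : b < 2 ^ m) :
    columnTerm (m + 1) σ (2 * k + a₀) b =
      if (a₀ + (σ 0 : ℕ)) % 2 = 0 then lowerTerm m (fun i => σ i.succ) k b
      else upperTerm m (fun i => σ i.succ) k b := by
  have e1 : (2 * k + a₀) / 2 = k := by omega
  have e2 : (2 * k + a₀ + (σ 0 : ℕ)) % 2 = (a₀ + (σ 0 : ℕ)) % 2 := by omega
  have hR := shiftedReversal_lt m (fun i => σ i.succ) k
  simp only [columnTerm, lowerTerm, upperTerm, shiftedReversal, e1, e2]
  generalize shiftedReversal m (fun i => σ i.succ) k = r at *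
  have hp : 2 ^ (m + 1) = 2 ^ m + 2 ^ m := by ring
  rcases Nat.mod_two_eq_zero_or_one (a₀ + (σ 0 : ℕ)) with h | h
  · have h3 : ¬ (2 ^ (m + 1) ≤ 0 * 2 ^ m + r + b) := by omega
    rw [h, if_neg h3]
    simp
    ring
  · have h3 : ¬ (1 * 2 ^ m + r ≤ b) := by omega
    have h4 : (2 ^ (m + 1) ≤ 1 * 2 ^ m + r + b) ↔ 2 ^ m ≤ r + b := by omega
    rw [h, if_neg h3]
    simp only [h4]
    simp
    ring

/-- In the upper half one of the two indicators is always 1. This extra 1 cancels the increase of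
the subtracted heights, and the roles of the two terms are exchanged. -/
theorem columnTerm_succ_high (m : ℕ) (σ : Fin (m + 1) → Fin 2) (k a₀ b : ℕ) (ha : a₀ < 2) :
    columnTerm (m + 1) σ (2 * k + a₀) (2 ^ m + b) =
      if (a₀ + (σ 0 : ℕ)) % 2 = 0 then upperTerm m (fun i => σ i.succ) k b
      else lowerTerm m (fun i => σ i.succ) k b := by
  have e1 : (2 * k + a₀) / 2 = k := by omega
  have e2 : (2 * k + a₀ + (σ 0 : ℕ)) % 2 = (a₀ + (σ 0 : ℕ)) % 2 := by omega
  have hR := shiftedReversal_lt m (fun i => σ i.succ) k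
  have hm : (2 : ℝ) ^ m ≠ 0 := by positivity
  simp only [columnTerm, lowerTerm, upperTerm, shiftedReversal, e1, e2]
  generalize shiftedReversal m (fun i => σ i.succ) k = r at *
  have hp : 2 ^ (m + 1) = 2 ^ m + 2 ^ m := by ring
  rcases Nat.mod_two_eq_zero_or_one (a₀ + (σ 0 : ℕ)) with h | h
  · have h3 : 0 * 2 ^ m + r ≤ 2 ^ m + b := by omega
    have h4 : (2 ^ (m + 1) ≤ 0 * 2 ^ m + r + (2 ^ m + b)) ↔ 2 ^ m ≤ r + b := by omega
    rw [h, if_pos h3]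
    simp only [h4]
    simp
    field_simp
    ring
  · have h3 : (1 * 2 ^ m + r ≤ 2 ^ m + b) ↔ r ≤ b := by omega
    have h4 : (2 ^ (m + 1) ≤ 1 * 2 ^ m + r + (2 ^ m + b)) := by omega
    rw [h, if_pos h4]
    simp only [h3]
    simp
    field_simp
    ring

theorem columnTerm_pair_low (m : ℕ) (σ : Fin (m + 1) → Fin 2) (k b : ℕ) (hb : b < 2 ^ m) :
    columnTerm (m + 1) σ (2 * k) b + columnTerm (m + 1) σ (2 * k + 1) b
      = columnTerm m (fun i => σ i.succ) k b := by
  have h0 := columnTerm_succ_low m σ k 0 b (by norm_num) hb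
  have h1 := columnTerm_succ_low m σ k 1 b (by norm_num) hb
  rw [add_zero] at h0
  rw [h0, h1, columnTerm]
  rcases Nat.mod_two_eq_zero_or_one (σ 0 : ℕ) with h | h
  · rw [if_pos (by omega), if_neg (by omega)]
  · rw [if_neg (by omega), if_pos (by omega), add_comm]

theorem columnTerm_pair_high (m : ℕ) (σ : Fin (m + 1) → Fin 2) (k b : ℕ) :
    columnTerm (m + 1) σ (2 * k) (2 ^ m + b) + columnTerm (m + 1) σ (2 * k + 1) (2 ^ m + b)
      = columnTerm m (fun i => σ i.succ) k b := by
  have h0 := columnTerm_succ_high m σ k 0 b (by norm_num)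
  have h1 := columnTerm_succ_high m σ k 1 b (by norm_num)
  rw [add_zero] at h0
  rw [h0, h1, columnTerm]
  rcases Nat.mod_two_eq_zero_or_one (σ 0 : ℕ) with h | h
  · rw [if_pos (by omega), if_neg (by omega), add_comm]
  · rw [if_neg (by omega), if_pos (by omega)]

theorem gridDiscrepancy_even_low (m : ℕ) (σ : Fin (m + 1) → Fin 2) (a b : ℕ) (hb : b < 2 ^ m) :
    gridDiscrepancy (m + 1) σ (2 * a) b = gridDiscrepancy m (fun i => σ i.succ) a b := by
  simp only [gridDiscrepancy, sum_range_two_mul_pairs, columnTerm_pair_low m σ _ b hb]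

theorem gridDiscrepancy_even_high (m : ℕ) (σ : Fin (m + 1) → Fin 2) (a b : ℕ) :
    gridDiscrepancy (m + 1) σ (2 * a) (2 ^ m + b)
      = gridDiscrepancy m (fun i => σ i.succ) a b := by
  simp only [gridDiscrepancy, sum_range_two_mul_pairs, columnTerm_pair_high m σ _ b]

theorem gridDiscrepancy_succ (m : ℕ) (σ : Fin m → Fin 2) (a b : ℕ) :
    gridDiscrepancy m σ (a + 1) b = gridDiscrepancy m σ a b + columnTerm m σ a b := by
  rw [gridDiscrepancy, Finset.sum_range_succ, gridDiscrepancy]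

/-! ### Quadratic sums over the grid -/

/-- The sum of `g` over the grid `{0, …, 2 ^ m - 1}²`. -/
def gridSum (m : ℕ) (g : ℕ → ℕ → ℝ) : ℝ :=
  ∑ a ∈ Finset.range (2 ^ m), ∑ b ∈ Finset.range (2 ^ m), g a b

theorem gridSum_succ (m : ℕ) (g : ℕ → ℕ → ℝ) :
    gridSum (m + 1) g = gridSum m (fun a b => g (2 * a) b + g (2 * a) (2 ^ m + b)
      + (g (2 * a + 1) b + g (2 * a + 1) (2 ^ m + b))) := by
  rw [gridSum, sum_range_two_pow_succ_low]
  simp only [gridSum, sum_range_two_pow_succ_high, Finset.sum_add_distrib]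

theorem gridSum_congr (m : ℕ) (f g : ℕ → ℕ → ℝ)
    (h : ∀ a b, b < 2 ^ m → f a b = g a b) : gridSum m f = gridSum m g :=
  Finset.sum_congr rfl fun a _ => Finset.sum_congr rfl fun b hb => h a b (Finset.mem_range.1 hb)

theorem gridSum_add (m : ℕ) (f g : ℕ → ℕ → ℝ) :
    gridSum m (fun a b => f a b + g a b) = gridSum m f + gridSum m g := by
  simp only [gridSum, Finset.sum_add_distrib]

theorem gridSum_const_mul (m : ℕ) (c : ℝ) (f : ℕ → ℕ → ℝ) :
    gridSum m (fun a b => c * f a b) = c * gridSum m f := by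
  simp only [gridSum, Finset.mul_sum]

theorem gridSum_sq_succ (m : ℕ) (σ : Fin (m + 1) → Fin 2) :
    gridSum (m + 1) (fun a b => gridDiscrepancy (m + 1) σ a b ^ 2)
      = 4 * gridSum m (fun a b => gridDiscrepancy m (fun i => σ i.succ) a b ^ 2)
        + 2 * gridSum m (fun a b => gridDiscrepancy m (fun i => σ i.succ) a b
            * columnTerm m (fun i => σ i.succ) a b)
        + gridSum m (fun a b => lowerTerm m (fun i => σ i.succ) a b ^ 2
            + upperTerm m (fun i => σ i.succ) a b ^ 2) := by
  rw [gridSum_succ, ← gridSum_const_mul, ← gridSum_const_mul, ← gridSum_add, ← gridSum_add]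
  refine gridSum_congr _ _ _ fun a b hb => ?_
  have h0 := columnTerm_succ_low m σ a 0 b (by norm_num) hb
  have h1 := columnTerm_succ_high m σ a 0 b (by norm_num)
  rw [add_zero] at h0 h1
  simp only [gridDiscrepancy_succ, gridDiscrepancy_even_low m σ a b hb,
    gridDiscrepancy_even_high m σ a b, h0, h1]
  rw [columnTerm]
  -- The value of the shifted digit only swaps the terms in the two halves, and the sum is symmetric
  -- in them.
  split_ifs <;> ring

theorem gridSum_mul_columnTerm_succ (m : ℕ) (σ : Fin (m + 1) → Fin 2) :
    gridSum (m + 1) (fun a b => gridDiscrepancy (m + 1) σ a b * columnTerm (m + 1) σ a b)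
      = 2 * gridSum m (fun a b => gridDiscrepancy m (fun i => σ i.succ) a b
            * columnTerm m (fun i => σ i.succ) a b)
        + 2 * gridSum m (fun a b => lowerTerm m (fun i => σ i.succ) a b
            * upperTerm m (fun i => σ i.succ) a b) := by
  rw [gridSum_succ, ← gridSum_const_mul, ← gridSum_const_mul, ← gridSum_add]
  refine gridSum_congr _ _ _ fun a b hb => ?_
  have h0 := columnTerm_succ_low m σ a 0 b (by norm_num) hb
  have h1 := columnTerm_succ_high m σ a 0 b (by norm_num)
  have h2 := columnTerm_succ_low m σ a 1 b (by norm_num) hb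
  have h3 := columnTerm_succ_high m σ a 1 b (by norm_num)
  rw [add_zero] at h0 h1
  simp only [gridDiscrepancy_succ, gridDiscrepancy_even_low m σ a b hb,
    gridDiscrepancy_even_high m σ a b, h0, h1, h2, h3]
  rw [columnTerm]
  split_ifs <;> first | omega | ring

theorem card_shiftedReversal_le (m : ℕ) (σ : Fin m → Fin 2) (b : ℕ) (hb : b < 2 ^ m) :
    ∑ k ∈ Finset.range (2 ^ m), (if shiftedReversal m σ k ≤ b then (1 : ℝ) else 0) = b + 1 := by
  induction m generalizing b with
  | zero => simp_all [shiftedReversal]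
  | succ m ih =>
    have hp : 2 ^ (m + 1) = 2 ^ m + 2 ^ m := by ring
    rw [sum_range_two_pow_succ_low]
    have e1 : ∀ k : ℕ, (2 * k + 1) / 2 = k := fun k => by omega
    have e2 : ∀ k : ℕ, (2 * k) / 2 = k := fun k => by omega
    have e3 : ∀ k : ℕ, (2 * k + 1 + (σ 0 : ℕ)) % 2 = 1 - (σ 0 : ℕ) := fun k => by omega
    have e4 : ∀ k : ℕ, (2 * k + (σ 0 : ℕ)) % 2 = (σ 0 : ℕ) := fun k => by omega
    simp only [shiftedReversal, e1, e2, e3, e4]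
    rcases lt_or_ge b (2 ^ m) with h | h
    · rw [← ih (fun i => σ i.succ) b h]
      refine Finset.sum_congr rfl fun k _ => ?_
      generalize shiftedReversal m (fun i => σ i.succ) k = r
      have h3 : ¬ (1 * 2 ^ m + r ≤ b) := by omega
      obtain h0 | h0 : (σ 0 : ℕ) = 0 ∨ (σ 0 : ℕ) = 1 := by omega
      · rw [h0, if_neg h3]; simp
      · rw [h0, if_neg h3]; simp
    · obtain ⟨b, rfl⟩ := Nat.exists_eq_add_of_le h
      have hb' : b < 2 ^ m := by omega
      have := ih (fun i => σ i.succ) b hb'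
      trans ∑ k ∈ Finset.range (2 ^ m),
        ((1 : ℝ) + if shiftedReversal m (fun i => σ i.succ) k ≤ b then (1 : ℝ) else 0)
      · refine Finset.sum_congr rfl fun k _ => ?_
        have hR := shiftedReversal_lt m (fun i => σ i.succ) k
        generalize shiftedReversal m (fun i => σ i.succ) k = r at *
        have h3 : (0 * 2 ^ m + r ≤ 2 ^ m + b) := by omega
        obtain h0 | h0 : (σ 0 : ℕ) = 0 ∨ (σ 0 : ℕ) = 1 := by omega
        · rw [h0, if_pos h3]; simp
        · rw [h0, Nat.sub_self, if_pos h3, add_comm]; simp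
      · rw [Finset.sum_add_distrib, this]
        push_cast
        simp
        ring

/-- Complement of the preceding count at `2 ^ m - 1 - b`. The two counts add up to `2 b + 1`, which
is why the height `(2 b + 1) / 2 ^ (m + 1)` centres each row. -/
theorem card_le_shiftedReversal_add (m : ℕ) (σ : Fin m → Fin 2) (b : ℕ) (hb : b < 2 ^ m) :
    ∑ k ∈ Finset.range (2 ^ m),
      (if 2 ^ m ≤ shiftedReversal m σ k + b then (1 : ℝ) else 0) = b := by
  rcases Nat.eq_zero_or_pos b with rfl | hpos
  · simp only [Nat.cast_zero]
    refine Finset.sum_eq_zero fun k _ => if_neg ?_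
    have := shiftedReversal_lt m σ k
    omega
  · have h := card_shiftedReversal_le m σ (2 ^ m - 1 - b) (by omega)
    have h2 : ∀ k, (if 2 ^ m ≤ shiftedReversal m σ k + b then (1 : ℝ) else 0)
        = 1 - if shiftedReversal m σ k ≤ 2 ^ m - 1 - b then (1 : ℝ) else 0 := by
      intro k
      split_ifs <;> first | omega | simp
    simp only [h2, Finset.sum_sub_distrib, h]
    rw [Nat.cast_sub (by omega), Nat.cast_sub (by omega)]
    simp
    ring

theorem sum_sq_add_sq (m : ℕ) (σ : Fin m → Fin 2) (b : ℕ) (hb : b < 2 ^ m) :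
    ∑ k ∈ Finset.range (2 ^ m), (lowerTerm m σ k b ^ 2 + upperTerm m σ k b ^ 2)
      = (2 * b + 1) - (2 * b + 1) ^ 2 / (2 * 2 ^ m) := by
  have h1 := card_shiftedReversal_le m σ b hb
  have h2 := card_le_shiftedReversal_add m σ b hb
  have hm : (2 : ℝ) ^ m ≠ 0 := by positivity
  -- Indicators are idempotent, so the squares are affine in them and the two counts suffice.
  have h3 : ∀ k, lowerTerm m σ k b ^ 2 + upperTerm m σ k b ^ 2
      = (1 - (2 * b + 1) / 2 ^ m) * ((if shiftedReversal m σ k ≤ b then (1 : ℝ) else 0)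
        + if 2 ^ m ≤ shiftedReversal m σ k + b then (1 : ℝ) else 0)
        + 2 * ((2 * b + 1) / 2 ^ (m + 1)) ^ 2 := by
    intro k
    simp only [lowerTerm, upperTerm, pow_succ]
    split_ifs <;> field_simp <;> ring
  simp only [h3, Finset.sum_add_distrib, ← Finset.mul_sum, h1, h2, Finset.sum_const,
    Finset.card_range, nsmul_eq_mul]
  push_cast
  field_simp
  ring

theorem sum_range_odd (n : ℕ) : ∑ b ∈ Finset.range n, (2 * (b : ℝ) + 1) = (n : ℝ) ^ 2 := by
  induction n with
  | zero => simp
  | succ n ih => rw [Finset.sum_range_succ, ih]; push_cast; ring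

theorem sum_range_odd_sq (n : ℕ) :
    ∑ b ∈ Finset.range n, (2 * (b : ℝ) + 1) ^ 2 = n * (4 * (n : ℝ) ^ 2 - 1) / 3 := by
  induction n with
  | zero => simp
  | succ n ih => rw [Finset.sum_range_succ, ih]; push_cast; ring

theorem gridSum_sq_add_sq (m : ℕ) (σ : Fin m → Fin 2) :
    gridSum m (fun a b => lowerTerm m σ a b ^ 2 + upperTerm m σ a b ^ 2)
      = 4 ^ m / 3 + 1 / 6 := by
  rw [gridSum, Finset.sum_comm, Finset.sum_congr rfl fun b hb =>
    sum_sq_add_sq m σ b (Finset.mem_range.1 hb), Finset.sum_sub_distrib, ← Finset.sum_div,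
    sum_range_odd, sum_range_odd_sq]
  have hm : (2 : ℝ) ^ m ≠ 0 := by positivity
  rw [show (4 : ℝ) = 2 ^ 2 by norm_num, ← pow_mul, mul_comm 2 m, pow_mul]
  push_cast
  field_simp
  ring

/-- After one digit is removed, each joint indicator either vanishes or reduces to a single
indicator of level `m`, so only the two row counts are needed. At level 0 the sum is 0, hence the
successor. -/
theorem gridSum_inter_succ (m : ℕ) (σ : Fin (m + 1) → Fin 2) :
    gridSum (m + 1) (fun k b => (if shiftedReversal (m + 1) σ k ≤ b then (1 : ℝ) else 0)
      * if 2 ^ (m + 1) ≤ shiftedReversal (m + 1) σ k + b then (1 : ℝ) else 0) = 4 ^ m := by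
  have h : gridSum m (fun k b =>
      (if shiftedReversal m (fun i => σ i.succ) k ≤ b then (1 : ℝ) else 0)
      + if 2 ^ m ≤ shiftedReversal m (fun i => σ i.succ) k + b then (1 : ℝ) else 0) = 4 ^ m := by
    rw [gridSum, Finset.sum_comm]
    simp only [Finset.sum_add_distrib]
    rw [← Finset.sum_add_distrib]
    trans ∑ b ∈ Finset.range (2 ^ m), (2 * (b : ℝ) + 1)
    · refine Finset.sum_congr rfl fun b hb => ?_
      rw [card_shiftedReversal_le _ _ _ (Finset.mem_range.1 hb),
        card_le_shiftedReversal_add _ _ _ (Finset.mem_range.1 hb)]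
      ring
    · rw [sum_range_odd]
      push_cast
      rw [← pow_mul, mul_comm m 2, pow_mul]
      norm_num
  rw [← h, gridSum_succ]
  refine gridSum_congr _ _ _ fun k b hb => ?_
  have hp : 2 ^ (m + 1) = 2 ^ m + 2 ^ m := by ring
  have e1 : (2 * k + 1) / 2 = k := by omega
  have e2 : (2 * k) / 2 = k := by omega
  have e3 : (2 * k + 1 + (σ 0 : ℕ)) % 2 = 1 - (σ 0 : ℕ) := by omega
  have e4 : (2 * k + (σ 0 : ℕ)) % 2 = (σ 0 : ℕ) := by omega
  simp only [shiftedReversal, e1, e2, e3, e4]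
  have hR := shiftedReversal_lt m (fun i => σ i.succ) k
  generalize shiftedReversal m (fun i => σ i.succ) k = r at *
  have h1 : ¬ 2 ^ (m + 1) ≤ r + b := by omega
  have h2 : r ≤ 2 ^ m + b := by omega
  have h3 : 2 ^ (m + 1) ≤ r + (2 ^ m + b) ↔ 2 ^ m ≤ r + b := by omega
  have h4 : ¬ 2 ^ m + r ≤ b := by omega
  have h5 : 2 ^ m + r ≤ 2 ^ m + b ↔ r ≤ b := by omega
  have h6 : 2 ^ (m + 1) ≤ 2 ^ m + r + (2 ^ m + b) := by omega
  obtain h0 | h0 : (σ 0 : ℕ) = 0 ∨ (σ 0 : ℕ) = 1 := by omega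
  · simp only [h0, Nat.sub_zero, zero_mul, one_mul, zero_add, h1, h2, h3, h4, h5, h6, if_true,
      if_false, mul_zero, mul_one]
    ring
  · simp only [h0, Nat.sub_self, zero_mul, one_mul, zero_add, h1, h2, h3, h4, h5, h6, if_true,
      if_false, mul_zero, mul_one]

theorem gridSum_mul_upperTerm_succ (m : ℕ) (σ : Fin (m + 1) → Fin 2) :
    gridSum (m + 1) (fun a b => lowerTerm (m + 1) σ a b * upperTerm (m + 1) σ a b)
      = - 4 ^ (m + 1) / 12 + 1 / 12 := by
  have hm : (2 : ℝ) ^ m ≠ 0 := by positivity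
  -- With indicators `i`, `j` and height `c`, `i j - (i - c) (j - c) = c (i + j) - c ^ 2`, which is
  -- affine in the indicators.
  have h : gridSum (m + 1) (fun k b =>
      (if shiftedReversal (m + 1) σ k ≤ b then (1 : ℝ) else 0)
        * (if 2 ^ (m + 1) ≤ shiftedReversal (m + 1) σ k + b then (1 : ℝ) else 0)
      + (-1) * (lowerTerm (m + 1) σ k b * upperTerm (m + 1) σ k b))
      = ∑ b ∈ Finset.range (2 ^ (m + 1)), (2 * (b : ℝ) + 1) ^ 2 / (4 * 2 ^ (m + 1)) := by
    rw [gridSum, Finset.sum_comm]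
    refine Finset.sum_congr rfl fun b hb => ?_
    have h1 := card_shiftedReversal_le _ σ _ (Finset.mem_range.1 hb)
    have h2 := card_le_shiftedReversal_add _ σ _ (Finset.mem_range.1 hb)
    trans ∑ k ∈ Finset.range (2 ^ (m + 1)), ((2 * (b : ℝ) + 1) / 2 ^ (m + 2)
        * ((if shiftedReversal (m + 1) σ k ≤ b then (1 : ℝ) else 0)
        + (if 2 ^ (m + 1) ≤ shiftedReversal (m + 1) σ k + b then (1 : ℝ) else 0))
        - ((2 * (b : ℝ) + 1) / 2 ^ (m + 2)) ^ 2)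
    · refine Finset.sum_congr rfl fun k _ => ?_
      rw [lowerTerm, upperTerm]
      ring
    · rw [Finset.sum_sub_distrib, ← Finset.mul_sum, Finset.sum_add_distrib, h1, h2,
        Finset.sum_const, Finset.card_range, nsmul_eq_mul]
      push_cast
      simp only [pow_succ]
      field_simp
      ring
  rw [gridSum_add, gridSum_const_mul, gridSum_inter_succ, ← Finset.sum_div,
    sum_range_odd_sq] at h
  have e : (4 : ℝ) ^ m = (2 ^ m) ^ 2 := by rw [← pow_mul, mul_comm m 2, pow_mul]; norm_num
  have h' : gridSum (m + 1) (fun a b => lowerTerm (m + 1) σ a b * upperTerm (m + 1) σ a b)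
      = 4 ^ m - (2 ^ (m + 1) : ℕ) * (4 * ((2 ^ (m + 1) : ℕ) : ℝ) ^ 2 - 1) / 3
        / (4 * 2 ^ (m + 1)) := by
    linarith
  rw [h', pow_succ (4 : ℝ), e]
  push_cast
  simp only [pow_succ (2 : ℝ) m]
  field_simp
  ring

theorem gridSum_mul_columnTerm (m : ℕ) (σ : Fin (m + 1) → Fin 2) :
    gridSum (m + 1) (fun a b => gridDiscrepancy (m + 1) σ a b * columnTerm (m + 1) σ a b)
      = - 4 ^ (m + 1) / 12 - 1 / 6 := by
  induction m with
  | zero =>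
    rw [gridSum_mul_columnTerm_succ]
    norm_num [gridSum, gridDiscrepancy, lowerTerm, upperTerm, shiftedReversal]
  | succ m ih =>
    rw [gridSum_mul_columnTerm_succ, ih, gridSum_mul_upperTerm_succ]
    ring

theorem gridSum_gridDiscrepancy_sq (m : ℕ) (σ : Fin (m + 1) → Fin 2) :
    gridSum (m + 1) (fun a b => gridDiscrepancy (m + 1) σ a b ^ 2)
      = 4 ^ (m + 1) * ((m + 1) / 24 + 5 / 72) + 1 / 18 := by
  induction m with
  | zero =>
    rw [gridSum_sq_succ, gridSum_sq_add_sq]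
    norm_num [gridSum, gridDiscrepancy]
  | succ m ih =>
    rw [gridSum_sq_succ, ih, gridSum_mul_columnTerm, gridSum_sq_add_sq]
    push_cast
    ring

/-! ### Triangle inequality in `L_2` -/

theorem sqrt_integral_sq_le {Ω : Type*} [MeasurableSpace Ω] {μ : Measure Ω}
    [IsProbabilityMeasure μ] {F G : Ω → ℝ} {c : ℝ} (hc : 0 < c)
    (hF : Integrable (fun z => F z ^ 2) μ) (hG : Integrable (fun z => G z ^ 2) μ)
    (h : ∀ᵐ z ∂μ, |F z - G z| ≤ c) :
    √(∫ z, F z ^ 2 ∂μ) ≤ √(∫ z, G z ^ 2 ∂μ) + c := by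
  -- The slack `δ` keeps `s + δ` positive when `s = 0`. The bound is `(x + y)² ≤ (1 + t) x² + (1 + 1
  -- / t) y²` with the near-optimal `t = c / (s + δ)`.
  refine le_of_forall_pos_le_add fun δ hδ => ?_
  set s := √(∫ z, G z ^ 2 ∂μ) with hs
  have hs0 : 0 ≤ s := Real.sqrt_nonneg _
  have hs2 : ∫ z, G z ^ 2 ∂μ = s ^ 2 :=
    (Real.sq_sqrt (integral_nonneg fun z => sq_nonneg _)).symm
  have hr : 0 < s + δ := by positivity
  have hle : ∫ z, F z ^ 2 ∂μ ≤
      ∫ z, ((1 + c / (s + δ)) * G z ^ 2 + (1 + (s + δ) / c) * c ^ 2) ∂μ := by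
    refine integral_mono_ae hF ((hG.const_mul _).add (integrable_const _)) ?_
    filter_upwards [h] with z hz
    have h1 : (F z - G z) ^ 2 ≤ c ^ 2 := sq_le_sq' (abs_le.1 hz).1 (abs_le.1 hz).2
    have h2 : 0 ≤ (c * G z - (s + δ) * (F z - G z)) ^ 2 / (c * (s + δ)) := by positivity
    have h3 : (1 + c / (s + δ)) * G z ^ 2 + (1 + (s + δ) / c) * (F z - G z) ^ 2 - F z ^ 2
        = (c * G z - (s + δ) * (F z - G z)) ^ 2 / (c * (s + δ)) := by
      field_simp
      ring
    have h4 : (1 + (s + δ) / c) * (F z - G z) ^ 2 ≤ (1 + (s + δ) / c) * c ^ 2 :=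
      mul_le_mul_of_nonneg_left h1 (by positivity)
    linarith
  rw [integral_add (hG.const_mul _) (integrable_const _), integral_const_mul, hs2,
    integral_const, probReal_univ, one_smul] at hle
  refine Real.sqrt_le_iff.2 ⟨by positivity, hle.trans ?_⟩
  have h5 : (1 + c / (s + δ)) * s ^ 2 ≤ (1 + c / (s + δ)) * (s + δ) ^ 2 :=
    mul_le_mul_of_nonneg_left (by nlinarith) (by positivity)
  have h6 : (1 + c / (s + δ)) * (s + δ) ^ 2 + (1 + (s + δ) / c) * c ^ 2 = (s + c + δ) ^ 2 := by
    field_simp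
    ring
  linarith

theorem abs_sqrt_integral_sq_sub_le {Ω : Type*} [MeasurableSpace Ω] {μ : Measure Ω}
    [IsProbabilityMeasure μ] {F G : Ω → ℝ} {c : ℝ} (hc : 0 < c)
    (hF : Integrable (fun z => F z ^ 2) μ) (hG : Integrable (fun z => G z ^ 2) μ)
    (h : ∀ᵐ z ∂μ, |F z - G z| ≤ c) :
    |√(∫ z, F z ^ 2 ∂μ) - √(∫ z, G z ^ 2 ∂μ)| ≤ c := by
  have h1 := sqrt_integral_sq_le hc hF hG h
  have h2 := sqrt_integral_sq_le hc hG hF (by simpa only [abs_sub_comm] using h)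
  exact abs_le.2 ⟨by linarith, by linarith⟩

/-! ### From the square to the grid -/

/-- The index of the cell `(k / n, (k + 1) / n]` that contains `x`. -/
def cellIndex (n : ℕ) (x : ℝ) : ℕ := ⌈(n : ℝ) * x⌉₊ - 1

theorem measurable_cellIndex (n : ℕ) : Measurable (cellIndex n) := by
  have h : Measurable fun x : ℝ => ⌈(n : ℝ) * x⌉₊ :=
    Nat.measurable_ceil.comp (measurable_const.mul measurable_id)
  exact (Measurable.of_discrete (f := fun k : ℕ => k - 1)).comp h

theorem integral_cellIndex (n : ℕ) (hn : 0 < n) (g : ℕ → ℝ) :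
    ∫ x in (0 : ℝ)..1, g (cellIndex n x) = (∑ k ∈ Finset.range n, g k) / n := by
  have hn' : (n : ℝ) ≠ 0 := by positivity
  have hcell : ∀ k : ℕ, ∀ x ∈ Set.Ioc (k : ℝ) ((k + 1 : ℕ) : ℝ), g (⌈x⌉₊ - 1) = g k := by
    intro k x hx
    have : ⌈x⌉₊ = k + 1 := (Nat.ceil_eq_iff (by omega)).2 (by simpa using hx)
    rw [this, Nat.add_sub_cancel]
  have hle : ∀ k : ℕ, (k : ℝ) ≤ ((k + 1 : ℕ) : ℝ) := fun k => by push_cast; linarith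
  have h := intervalIntegral.sum_integral_adjacent_intervals (μ := volume)
    (f := fun x : ℝ => g (⌈x⌉₊ - 1)) (a := fun k : ℕ => (k : ℝ)) (n := n) (fun k _ => by
      rw [intervalIntegrable_iff_integrableOn_Ioc_of_le (hle k)]
      exact (integrableOn_congr_fun (hcell k) measurableSet_Ioc).2 (by simp))
  unfold cellIndex
  rw [intervalIntegral.integral_comp_mul_left (fun x : ℝ => g (⌈x⌉₊ - 1)) hn', mul_zero,
    mul_one, smul_eq_mul, inv_mul_eq_div]
  congr 1
  rw [Nat.cast_zero] at h
  rw [← h]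
  refine Finset.sum_congr rfl fun k _ => ?_
  rw [intervalIntegral.integral_of_le (hle k),
    setIntegral_congr_fun measurableSet_Ioc (hcell k)]
  simp

theorem cellIndex_lt (n : ℕ) (hn : 0 < n) {x : ℝ} (hx : x ≤ 1) : cellIndex n x < n := by
  have h : ⌈(n : ℝ) * x⌉₊ ≤ n :=
    Nat.ceil_le.2 (mul_le_of_le_one_right (Nat.cast_nonneg n) hx)
  unfold cellIndex
  omega

theorem ceil_eq_cellIndex_add_one (n : ℕ) (hn : 0 < n) {x : ℝ} (hx : 0 < x) :
    ⌈(n : ℝ) * x⌉₊ = cellIndex n x + 1 := by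
  have h : 0 < ⌈(n : ℝ) * x⌉₊ := Nat.ceil_pos.2 (by positivity)
  unfold cellIndex
  omega

theorem natCast_div_lt_iff (n : ℕ) (hn : 0 < n) {x : ℝ} (hx : 0 < x) (k : ℕ) :
    (k : ℝ) / n < x ↔ k < cellIndex n x + 1 := by
  rw [← ceil_eq_cellIndex_add_one n hn hx, Nat.lt_ceil, div_lt_iff₀ (by positivity), mul_comm]

/-- The pair is `(β, α)`, so that Fubini yields the order of integration in `lpDiscrepancy`. -/
theorem measurable_countInBox (P : Multiset (ℝ × ℝ)) :
    Measurable fun z : ℝ × ℝ => countInBox P z.2 z.1 := by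
  classical
  induction P using Multiset.induction_on with
  | empty => simp [countInBox]
  | cons w P ih =>
    have h : (fun z : ℝ × ℝ => countInBox (w ::ₘ P) z.2 z.1) = fun z => countInBox P z.2 z.1 +
        if (0 ≤ w.1 ∧ w.1 < z.2) ∧ (0 ≤ w.2 ∧ w.2 < z.1) then 1 else 0 := by
      funext z
      simp only [countInBox, Multiset.countP_cons, Set.mem_prod, Set.mem_Ico]
    rw [h]
    refine ih.add (Measurable.ite ?_ measurable_const measurable_const)
    exact ((MeasurableSet.const _).inter (measurableSet_lt measurable_const measurable_snd)).inter
      ((MeasurableSet.const _).inter (measurableSet_lt measurable_const measurable_fst))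

theorem measurable_localDiscrepancy (P : Multiset (ℝ × ℝ)) :
    Measurable fun z : ℝ × ℝ => localDiscrepancy P z.2 z.1 := by
  unfold localDiscrepancy
  exact ((Measurable.of_discrete (f := fun k : ℕ => (k : ℝ))).comp
    (measurable_countInBox P)).sub ((measurable_const.mul measurable_snd).mul measurable_fst)

theorem countInBox_le_card (P : Multiset (ℝ × ℝ)) (α β : ℝ) :
    countInBox P α β ≤ Multiset.card P := by
  classical
  exact Multiset.countP_le_card _ _

theorem card_altSymHammersley (m : ℕ) (σ : Fin m → Fin 2) :
    Multiset.card (altSymHammersley m σ) = 2 ^ (m + 1) := by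
  simp [altSymHammersley, hammersley, pow_succ, mul_two]

theorem countInBox_altSymHammersley (m : ℕ) (σ : Fin m → Fin 2) {α β : ℝ}
    (hα : α ∈ Set.Ioc (0 : ℝ) 1) (hβ : β ∈ Set.Ioc (0 : ℝ) 1) :
    (countInBox (altSymHammersley m σ) α β : ℝ)
      = ∑ k ∈ Finset.range (cellIndex (2 ^ m) α + 1),
        ((if shiftedReversal m σ k ≤ cellIndex (2 ^ m) β then (1 : ℝ) else 0)
          + if 2 ^ m ≤ shiftedReversal m σ k + cellIndex (2 ^ m) β then (1 : ℝ) else 0) := by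
  classical
  have hn : 0 < 2 ^ m := by positivity
  have hn' : (0 : ℝ) < 2 ^ m := by positivity
  have hcount : ∀ f : ℝ × ℝ → ℝ × ℝ,
      (countInBox ((hammersley m σ).map f) α β : ℝ)
        = ∑ k ∈ Finset.range (2 ^ m), if f ((k : ℝ) / 2 ^ m, (shiftedReversal m σ k : ℝ) / 2 ^ m)
            ∈ Set.Ico 0 α ×ˢ Set.Ico 0 β then (1 : ℝ) else 0 := by
    intro f
    rw [← sum_hammersleyPoint m σ
      (fun z => if f z ∈ Set.Ico 0 α ×ˢ Set.Ico 0 β then (1 : ℝ) else 0), Finset.sum_boole]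
    simp only [countInBox, hammersley, Multiset.map_map, Multiset.countP_map]
    rfl
  have hsplit : (countInBox (altSymHammersley m σ) α β : ℝ)
      = countInBox ((hammersley m σ).map id) α β
        + countInBox ((hammersley m σ).map fun z => (z.1, 1 - z.2)) α β := by
    simp only [countInBox, altSymHammersley, Multiset.countP_add, Multiset.map_id]
    push_cast
    rfl
  have ha := cellIndex_lt (2 ^ m) hn hα.2
  rw [hsplit, hcount, hcount, ← Finset.sum_add_distrib,
    ← Finset.sum_subset (Finset.range_subset_range.2 (Nat.succ_le_of_lt ha))]
  · refine Finset.sum_congr rfl fun k hk => ?_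
    have hR := shiftedReversal_lt m σ k
    have h1 := (natCast_div_lt_iff (2 ^ m) hn hα.1 k).2 (Finset.mem_range.1 hk)
    have h2 := natCast_div_lt_iff (2 ^ m) hn hβ.1 (shiftedReversal m σ k)
    have h3 := natCast_div_lt_iff (2 ^ m) hn hβ.1 (2 ^ m - shiftedReversal m σ k)
    rw [Nat.cast_sub hR.le] at h3
    push_cast at h1 h2 h3
    rw [sub_div, div_self hn'.ne'] at h3
    have h4 : (0 : ℝ) ≤ (k : ℝ) / 2 ^ m := by positivity
    have h5 : (0 : ℝ) ≤ (shiftedReversal m σ k : ℝ) / 2 ^ m := by positivity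
    have h6 : (0 : ℝ) ≤ 1 - (shiftedReversal m σ k : ℝ) / 2 ^ m := by
      rw [sub_nonneg, div_le_one hn']
      exact_mod_cast hR.le
    have h7 : 2 ^ m - shiftedReversal m σ k < cellIndex (2 ^ m) β + 1
        ↔ 2 ^ m ≤ shiftedReversal m σ k + cellIndex (2 ^ m) β := by omega
    simp only [id, Set.mem_prod, Set.mem_Ico, h1, h2, h3, h4, h5, h6, h7, true_and,
      Nat.lt_succ_iff]
  · intro k _ hk
    have h1 : ¬ (k : ℝ) / 2 ^ m < α := by
      have := natCast_div_lt_iff (2 ^ m) hn hα.1 k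
      push_cast at this
      rw [this]
      simpa using hk
    simp [Set.mem_prod, Set.mem_Ico, h1]

theorem abs_localDiscrepancy_sub_gridDiscrepancy_le (m : ℕ) (σ : Fin m → Fin 2) {α β : ℝ}
    (hα : α ∈ Set.Ioc (0 : ℝ) 1) (hβ : β ∈ Set.Ioc (0 : ℝ) 1) :
    |localDiscrepancy (altSymHammersley m σ) α β
      - gridDiscrepancy m σ (cellIndex (2 ^ m) α) (cellIndex (2 ^ m) β)| ≤ 3 := by
  have hn : 0 < 2 ^ m := by positivity
  have hn' : (0 : ℝ) < 2 ^ m := by positivity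
  have ca := ceil_eq_cellIndex_add_one (2 ^ m) hn hα.1
  have cb := ceil_eq_cellIndex_add_one (2 ^ m) hn hβ.1
  have la := cellIndex_lt (2 ^ m) hn hα.2
  have lb := cellIndex_lt (2 ^ m) hn hβ.2
  rw [localDiscrepancy, countInBox_altSymHammersley m σ hα hβ, card_altSymHammersley]
  rw [Nat.ceil_eq_iff (by omega)] at ca cb
  generalize cellIndex (2 ^ m) α = a at *
  generalize cellIndex (2 ^ m) β = b at *
  push_cast at ca cb
  have la' : (a : ℝ) + 1 ≤ 2 ^ m := by exact_mod_cast la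
  have lb' : (b : ℝ) + 1 ≤ 2 ^ m := by exact_mod_cast lb
  have hD : gridDiscrepancy m σ a b = ∑ k ∈ Finset.range a,
        ((if shiftedReversal m σ k ≤ b then (1 : ℝ) else 0)
          + if 2 ^ m ≤ shiftedReversal m σ k + b then (1 : ℝ) else 0)
        - a * (2 * b + 1) / 2 ^ m := by
    simp only [gridDiscrepancy, columnTerm, lowerTerm, upperTerm, Finset.sum_add_distrib,
      Finset.sum_sub_distrib, Finset.sum_const, Finset.card_range, nsmul_eq_mul, pow_succ]
    field_simp
    ring
  have h0 : (0 : ℝ) ≤ (if shiftedReversal m σ a ≤ b then (1 : ℝ) else 0)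
      + (if 2 ^ m ≤ shiftedReversal m σ a + b then (1 : ℝ) else 0) := by positivity
  have h2 : (if shiftedReversal m σ a ≤ b then (1 : ℝ) else 0)
      + (if 2 ^ m ≤ shiftedReversal m σ a + b then (1 : ℝ) else 0) ≤ 2 := by
    split_ifs <;> norm_num
  have ha0 : (0 : ℝ) ≤ a := Nat.cast_nonneg a
  have hb0 : (0 : ℝ) ≤ b := Nat.cast_nonneg b
  have hlow : (a : ℝ) * b ≤ (2 ^ m * α) * (2 ^ m * β) :=
    mul_le_mul ca.1.le cb.1.le hb0 (by linarith)
  have hupp : (2 ^ m * α) * (2 ^ m * β) ≤ ((a : ℝ) + 1) * (b + 1) :=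
    mul_le_mul ca.2 cb.2 (by linarith) (by linarith)
  have e : ((2 ^ (m + 1) : ℕ) : ℝ) * α * β - a * (2 * b + 1) / 2 ^ m
      = (2 * ((2 ^ m * α) * (2 ^ m * β)) - a * (2 * b + 1)) / 2 ^ m := by
    push_cast
    field_simp
    ring
  have h3 : (2 * ((2 ^ m * α) * (2 ^ m * β)) - a * (2 * b + 1)) / 2 ^ m ≤ 3 := by
    rw [div_le_iff₀ hn']
    linarith
  have h4 : -1 ≤ (2 * ((2 ^ m * α) * (2 ^ m * β)) - a * (2 * b + 1)) / 2 ^ m := by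
    rw [le_div_iff₀ hn']
    linarith
  -- The count has one more column than the grid sum, worth between 0 and 2, and the volume terms
  -- differ by between -1 and 3; hence the bound 3.
  rw [Finset.sum_range_succ, hD]
  rw [abs_le]
  constructor <;> linarith

/-! ### Integrals over the unit square and conclusion -/

/-- The unit square without its left and lower edges. -/
def unitSquare : Set (ℝ × ℝ) := Set.Ioc 0 1 ×ˢ Set.Ioc 0 1

instance isProbabilityMeasure_unitSquare :
    IsProbabilityMeasure ((volume : Measure (ℝ × ℝ)).restrict unitSquare) :=
  ⟨by rw [Measure.restrict_apply_univ, unitSquare, Measure.volume_eq_prod, Measure.prod_prod]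
      simp⟩

theorem measurableSet_unitSquare : MeasurableSet unitSquare :=
  measurableSet_Ioc.prod measurableSet_Ioc

theorem integral_unitSquare (F : ℝ × ℝ → ℝ)
    (hF : Integrable F ((volume : Measure (ℝ × ℝ)).restrict unitSquare)) :
    ∫ z in unitSquare, F z = ∫ y in (0 : ℝ)..1, ∫ x in (0 : ℝ)..1, F (y, x) := by
  rw [Measure.volume_eq_prod] at *
  rw [unitSquare, setIntegral_prod _ hF, intervalIntegral.integral_of_le zero_le_one]
  simp only [intervalIntegral.integral_of_le zero_le_one]

theorem abs_sqrt_sub_sqrt_le {x y c : ℝ} (hx : 0 ≤ x) (hy : 0 ≤ y) (hc : 0 ≤ c)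
    (h : |x - y| ≤ c ^ 2) : |√x - √y| ≤ c := by
  have key : ∀ u v : ℝ, 0 ≤ v → u ≤ v + c ^ 2 → √u ≤ √v + c := fun u v hv huv => by
    rw [Real.sqrt_le_iff]
    have := Real.sq_sqrt hv
    exact ⟨by positivity, by nlinarith [Real.sqrt_nonneg v]⟩
  have h' := abs_le.1 h
  have h1 := key x y hy (by linarith)
  have h2 := key y x hx (by linarith)
  exact abs_le.2 ⟨by linarith, by linarith⟩

theorem integral_gridDiscrepancy_sq (m : ℕ) (σ : Fin (m + 1) → Fin 2) :
    ∫ β in (0 : ℝ)..1, ∫ α in (0 : ℝ)..1, gridDiscrepancy (m + 1) σ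
        (cellIndex (2 ^ (m + 1)) α) (cellIndex (2 ^ (m + 1)) β) ^ 2
      = (m + 1) / 24 + 5 / 72 + 1 / (18 * 4 ^ (m + 1)) := by
  have hn : 0 < 2 ^ (m + 1) := by positivity
  have h := gridSum_gridDiscrepancy_sq m σ
  rw [gridSum, Finset.sum_comm] at h
  have h1 : ∀ b : ℕ, ∫ α in (0 : ℝ)..1,
      gridDiscrepancy (m + 1) σ (cellIndex (2 ^ (m + 1)) α) b ^ 2
      = (∑ a ∈ Finset.range (2 ^ (m + 1)), gridDiscrepancy (m + 1) σ a b ^ 2)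
        / (2 ^ (m + 1) : ℕ) := fun b =>
    integral_cellIndex (2 ^ (m + 1)) hn fun a => gridDiscrepancy (m + 1) σ a b ^ 2
  simp only [h1]
  rw [integral_cellIndex (2 ^ (m + 1)) hn (fun b =>
    (∑ a ∈ Finset.range (2 ^ (m + 1)), gridDiscrepancy (m + 1) σ a b ^ 2)
        / (2 ^ (m + 1) : ℕ)), ← Finset.sum_div, h]
  have e : (4 : ℝ) ^ (m + 1) = (2 ^ (m + 1)) ^ 2 := by
    rw [← pow_mul, mul_comm (m + 1) 2, pow_mul]; norm_num
  rw [e]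
  push_cast
  field_simp

theorem abs_localDiscrepancy_le_card (P : Multiset (ℝ × ℝ)) {α β : ℝ}
    (hα : α ∈ Set.Ioc (0 : ℝ) 1) (hβ : β ∈ Set.Ioc (0 : ℝ) 1) :
    |localDiscrepancy P α β| ≤ Multiset.card P := by
  have h1 : (countInBox P α β : ℝ) ≤ Multiset.card P := by
    exact_mod_cast countInBox_le_card P α β
  have h2 : (0 : ℝ) ≤ countInBox P α β := Nat.cast_nonneg _
  have h3 : (Multiset.card P : ℝ) * α * β ≤ Multiset.card P := by
    rw [mul_assoc]
    exact mul_le_of_le_one_right (Nat.cast_nonneg _) (mul_le_one₀ hα.2 hβ.1.le hβ.2)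
  have h4 : 0 ≤ (Multiset.card P : ℝ) * α * β :=
    mul_nonneg (mul_nonneg (Nat.cast_nonneg _) hα.1.le) hβ.1.le
  rw [localDiscrepancy, abs_le]
  constructor <;> linarith

theorem abs_sqrt_integral_localDiscrepancy_sub_step_le (P : Multiset (ℝ × ℝ)) (n : ℕ)
    (g : ℕ → ℕ → ℝ) {c : ℝ} (hc : 0 < c)
    (h : ∀ α ∈ Set.Ioc (0 : ℝ) 1, ∀ β ∈ Set.Ioc (0 : ℝ) 1,
      |localDiscrepancy P α β - g (cellIndex n α) (cellIndex n β)| ≤ c) :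
    |√(∫ β in (0 : ℝ)..1, ∫ α in (0 : ℝ)..1, localDiscrepancy P α β ^ 2)
      - √(∫ β in (0 : ℝ)..1, ∫ α in (0 : ℝ)..1, g (cellIndex n α) (cellIndex n β) ^ 2)| ≤ c := by
  have hFm := measurable_localDiscrepancy P
  have hGm : Measurable fun z : ℝ × ℝ => g (cellIndex n z.2) (cellIndex n z.1) :=
    (Measurable.of_discrete (f := fun p : ℕ × ℕ => g p.1 p.2)).comp
      (((measurable_cellIndex n).comp measurable_snd).prodMk
        ((measurable_cellIndex n).comp measurable_fst))
  have hmem : ∀ᵐ z ∂(volume : Measure (ℝ × ℝ)).restrict unitSquare, z ∈ unitSquare :=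
    ae_restrict_mem measurableSet_unitSquare
  have hF : Integrable (fun z : ℝ × ℝ => localDiscrepancy P z.2 z.1 ^ 2)
      ((volume : Measure (ℝ × ℝ)).restrict unitSquare) := by
    refine Integrable.of_bound (hFm.pow_const 2).aestronglyMeasurable
      ((Multiset.card P : ℝ) ^ 2) ?_
    filter_upwards [hmem] with z hz
    rw [norm_pow, Real.norm_eq_abs]
    exact pow_le_pow_left₀ (abs_nonneg _) (abs_localDiscrepancy_le_card P hz.2 hz.1) 2
  have hG : Integrable (fun z : ℝ × ℝ => g (cellIndex n z.2) (cellIndex n z.1) ^ 2)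
      ((volume : Measure (ℝ × ℝ)).restrict unitSquare) := by
    refine Integrable.of_bound (hGm.pow_const 2).aestronglyMeasurable
      ((Multiset.card P + c : ℝ) ^ 2) ?_
    filter_upwards [hmem] with z hz
    rw [norm_pow, Real.norm_eq_abs]
    refine pow_le_pow_left₀ (abs_nonneg _) ?_ 2
    have h1 := abs_le.1 (abs_localDiscrepancy_le_card P hz.2 hz.1)
    have h2 := abs_le.1 (h _ hz.2 _ hz.1)
    rw [abs_le]
    constructor <;> linarith
  have hdiff : ∀ᵐ z ∂(volume : Measure (ℝ × ℝ)).restrict unitSquare,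
      |localDiscrepancy P z.2 z.1 - g (cellIndex n z.2) (cellIndex n z.1)| ≤ c := by
    filter_upwards [hmem] with z hz
    exact h _ hz.2 _ hz.1
  have key := abs_sqrt_integral_sq_sub_le hc hF hG hdiff
  rwa [integral_unitSquare _ hF, integral_unitSquare _ hG] at key

theorem abs_sqrt_integral_localDiscrepancy_sub_le (m : ℕ) (σ : Fin (m + 1) → Fin 2) :
    |√(∫ β in (0 : ℝ)..1, ∫ α in (0 : ℝ)..1,
        localDiscrepancy (altSymHammersley (m + 1) σ) α β ^ 2) - √((m + 2) / 24)| ≤ 4 := by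
  have h := abs_sqrt_integral_localDiscrepancy_sub_step_le (altSymHammersley (m + 1) σ)
    (2 ^ (m + 1)) (gridDiscrepancy (m + 1) σ) (c := 3) (by norm_num)
    fun α hα β hβ => abs_localDiscrepancy_sub_gridDiscrepancy_le (m + 1) σ hα hβ
  rw [integral_gridDiscrepancy_sq] at h
  have h4 : (1 : ℝ) / (18 * 4 ^ (m + 1)) ≤ 1 / 18 := by
    apply one_div_le_one_div_of_le (by norm_num)
    have : (1 : ℝ) ≤ 4 ^ (m + 1) := one_le_pow₀ (by norm_num)
    linarith
  have h5 : (0 : ℝ) < 1 / (18 * 4 ^ (m + 1)) := by positivity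
  -- Here `(m + 2) / 24` is `log N / (24 log 2)` for level `m + 1`. Replacing the exact mean square
  -- by it costs at most 1, which with the discretization error 3 gives 4.
  have h6 := abs_sqrt_sub_sqrt_le (x := (m + 1) / 24 + 5 / 72 + 1 / (18 * 4 ^ (m + 1)))
    (y := ((m : ℝ) + 2) / 24) (c := 1) (by positivity) (by positivity) zero_le_one
    (by rw [abs_le]; constructor <;> linarith)
  have h7 := abs_sub_le (√(∫ β in (0 : ℝ)..1, ∫ α in (0 : ℝ)..1,
    localDiscrepancy (altSymHammersley (m + 1) σ) α β ^ 2))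
    (√((m + 1) / 24 + 5 / 72 + 1 / (18 * 4 ^ (m + 1)))) (√(((m : ℝ) + 2) / 24))
  linarith

theorem lpDiscrepancy_two (P : Multiset (ℝ × ℝ)) :
    lpDiscrepancy 2 P = 1 / (Multiset.card P : ℝ) *
      √(∫ β in (0 : ℝ)..1, ∫ α in (0 : ℝ)..1, localDiscrepancy P α β ^ 2) := by
  simp only [lpDiscrepancy, Real.sqrt_eq_rpow, Real.rpow_two, sq_abs]

end

theorem mainTheorem2 :
    ∃ C : ℝ, ∀ m : ℕ, 1 ≤ m → ∀ σ : Fin m → Fin 2, ∀ N : ℕ, N = 2 ^ (m + 1) →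
      Multiset.card (altSymHammersley m σ) = N ∧
      |lpDiscrepancy 2 (altSymHammersley m σ)
          - 1 / (N : ℝ) * Real.sqrt (Real.log N / (24 * Real.log 2))| ≤ C * (1 / (N : ℝ)) := by
  refine ⟨4, fun m hm σ N hN => ?_⟩
  have hcard := card_altSymHammersley m σ
  rw [← hN] at hcard
  refine ⟨hcard, ?_⟩
  obtain ⟨m, rfl⟩ := Nat.exists_eq_add_of_le' hm
  have hlog : Real.log N / (24 * Real.log 2) = ((m : ℝ) + 2) / 24 := by
    have h2 : Real.log 2 ≠ 0 := (Real.log_pos one_lt_two).ne'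
    rw [hN]
    push_cast
    rw [Real.log_pow]
    push_cast
    field_simp
    ring
  rw [lpDiscrepancy_two, hcard, hlog, ← mul_sub, abs_mul, abs_of_nonneg (by positivity),
    mul_comm]
  exact mul_le_mul_of_nonneg_right (abs_sqrt_integral_localDiscrepancy_sub_le m σ)
    (by positivity)
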